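/- **Theorem.** Strong bisimilarity is a congruence for all operators of the following (non-probabilistic) process algebra for link layer protocols. *Data.* Fix a data structure with types for time ($\mathbb Z$), network layer data, messages, node identifiers ($\mathrm{IP}$), sets of node identifiers, Booleans and possibly further types; typed data variables; (possibly partial) operators and predicates; and a function $\mathrm{dur}$ assigning to each message a positive integer. A chunk $ch$ is $m{:}c$ (with $m$ a message, $1\le c\le \mathrm{dur}(m)$), $\mathsf{conflict}$ or $\mathsf{idle}$. A valuation $\xi$ assigns values to the special variables $\mathtt{now}\in\mathbb Z$, $\mathtt{rfr}$ (a chunk) and $\mathtt{cntr}\in\mathbb N$, and to some of the data variables. Data expressions may use $\mathtt{now}$, and refer to $\mathtt{rfr}$ only through $\mathrm{new}(m):=(\mathtt{rfr}=m{:}\mathrm{dur}(m))$ and $\mathrm{idle}:=(\mathtt{rfr}=\mathsf{idle})$; formulas are those of first-order logic. Put $r\star ch=ch$ if $ch\in\{\mathsf{conflict},\mathsf{idle}\}$, or $ch=m{:}1$, or $ch=m{:}(c{+}1)$ and $r=m{:}c$; otherwise $r\star ch=\mathsf{conflict}$. Let $\xi^{ch}:=\xi[\mathtt{rfr}:=\mathtt{rfr}\star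 ch,\ \mathtt{now}:=\mathtt{now}+1]$. Write $\xi\xrightarrow{\varphi}\zeta$ if $\zeta$ extends $\xi$ exactly by values for the free variables of $\varphi$ undefined in $\xi$, and $\varphi$ holds under $\zeta$. *Sequential processes.* Expressions are $$P ::= X(e_1,\dots,e_n)\mid [\varphi]P\mid [\![x:=e]\!]P\mid \mathbf{transmit}(ms).P\mid \mathbf{newpkt}(x,y).P\mid \mathbf{deliver}(x).P\mid P+P,$$ where each process name $X$ has a defining equation $X(x_1,\dots,x_n)\stackrel{def}{=}P_X$. States are pairs $(\xi,P)$; the transitions are generated by the following rules, for all chunks $ch$, data $d$ and identifiers $i$. 1. Let $m=\xi(ms)$ and $c=\xi(\mathtt{cntr})+1$. Then $\xi,\mathbf{transmit}(ms).P\xrightarrow{\mathbf{transmit}(m,c,ch)}\xi^{ch}[\mathtt{cntr}:=c],\mathbf{transmit}(m).P$ if $c<\mathrm{dur}(m)$, and $\xrightarrow{\mathbf{transmit}(m,c,ch)}\xi^{ch}[\mathtt{cntr}:=0],P$ if $c=\mathrm{dur}(m)$. 2. $\xi,\mathbf{newpkt}(x,y).P\xrightarrow{\mathbf{newpkt}(d,i)}\xi[x:=d,y:=i],P$,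 and $\xi,\mathbf{newpkt}(x,y).P\xrightarrow{\mathbf{wait}(ch)}\xi^{ch},\mathbf{newpkt}(x,y).P$. 3. $\xi,\mathbf{deliver}(x).P\xrightarrow{\mathbf{deliver}(\xi(x))}\xi,P$, and $\xi,[\![x:=e]\!]P\xrightarrow{\tau}\xi[x:=\xi(e)],P$. 4. Let $\xi'$ be $\xi$ restricted to $\mathtt{now},\mathtt{rfr},\mathtt{cntr}$ and updated with $x_j:=\xi(e_j)$ for all $j$. If $\xi',P_X\xrightarrow{a}\zeta,P'$, then $\xi,X(e_1,\dots,e_n)\xrightarrow{a}\zeta,P'$ when $a$ is not a $\mathbf{wait}$ action, and $\xi,X(e_1,\dots,e_n)\xrightarrow{a}\xi^{ch},X(e_1,\dots,e_n)$ when $a=\mathbf{wait}(ch)$. 5. If $P$ is a call, assignment, transmit or deliver expression of which a data expression is undefined under $\xi$, then $\xi,P\xrightarrow{\mathbf{wait}(ch)}\xi^{ch},P$. 6. $P+Q$ has all non-$\mathbf{wait}$ transitions of $P$ and of $Q$; and $\xi,P+Q\xrightarrow{\mathbf{wait}(ch)}\zeta,P'+Q'$ if $\xi,P\xrightarrow{\mathbf{wait}(ch)}\zeta,P'$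 and $\xi,Q\xrightarrow{\mathbf{wait}(ch)}\zeta',Q'$. 7. $\xi,[\varphi]P\xrightarrow{\tau}\zeta,P$ if $\xi\xrightarrow{\varphi}\zeta$; and $\xi,[\varphi]P\xrightarrow{\mathbf{wait}(ch)}\xi^{ch},[\varphi]P$ if there is no such $\zeta$. *Networks.* Partial networks are $M ::= id{:}(\xi,P){:}R\mid M\| M$, with $id\in\mathrm{IP}$ and range $R\subseteq\mathrm{IP}$; complete networks are $[M]$. All identifiers of a network, including those in ranges, are taken from a set $T\subseteq\mathrm{IP}$. The labels $\mathbf{traffic}(\mathcal T,\mathcal R)$ carry partial functions $\mathcal T,\mathcal R$ from $\mathrm{IP}$ to chunks. * A node $id{:}s{:}R$ turns $s\xrightarrow{\mathbf{wait}(ch)}s'$ into $\mathbf{traffic}(\emptyset,\mathcal R)$ and $s\xrightarrow{\mathbf{transmit}(m,c,ch)}s'$ into $\mathbf{traffic}(\{(r,m{:}c)\mid r\in R\},\mathcal R)$, where $\mathcal R=\emptyset$ if $ch=\mathsf{idle}$ and $\mathcal R=\{(id,ch)\}$ otherwise. It turns $\mathbf{deliver}(d)$ and $\mathbf{newpkt}(d,i)$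 into $id{:}\mathbf{deliver}(d)$ and $id{:}\mathbf{newpkt}(d,i)$, and keeps $\tau$. * A node $id{:}s{:}R$ has transitions $\mathbf{connect}(id,i)$ and $\mathbf{connect}(i,id)$ to $id{:}s{:}R\cup\{i\}$ (for $i\in T$), $\mathbf{disconnect}(id,i)$ and $\mathbf{disconnect}(i,id)$ to $id{:}s{:}R\setminus\{i\}$, and $\mathbf{connect}(i,j)$ and $\mathbf{disconnect}(i,j)$ to itself if $id\notin\{i,j\}$. * In $M\|N$ the actions $\tau$, $id{:}\mathbf{deliver}(d)$ and $id{:}\mathbf{newpkt}(d,i)$ are interleaved, $\mathbf{connect}(i,j)$ and $\mathbf{disconnect}(i,j)$ are performed jointly, and $\mathbf{traffic}(\mathcal T_1,\mathcal R_1)$, $\mathbf{traffic}(\mathcal T_2,\mathcal R_2)$ synchronise to $\mathbf{traffic}(\mathcal T_1\uplus\mathcal T_2,\mathcal R_1\uplus\mathcal R_2)$, where $\uplus$ is union with value $\mathsf{conflict}$ wherever both functions are defined. * $[M]$ keeps all transitions of $M$ except $\mathbf{traffic}$; and $[M]\xrightarrow{\mathbf{tick}}[M']$ if $M\xrightarrow{\mathbf{traffic}(\mathcal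 R,\mathcal R)}M'$ for some $\mathcal R$. *Claim.* Let $\leftrightarrow$ be strong bisimilarity on sequential states, on partial networks and on complete networks, and for sequential process expressions write $P\leftrightarrow P'$ if $(\xi,P)\leftrightarrow(\xi,P')$ for every valuation $\xi$. All these relations are equivalences, and: (a) if $P\leftrightarrow P'$ and $Q\leftrightarrow Q'$ then $[\varphi]P\leftrightarrow[\varphi]P'$, $[\![x:=e]\!]P\leftrightarrow[\![x:=e]\!]P'$, $\alpha.P\leftrightarrow\alpha.P'$ for each prefix $\alpha$ ($\mathbf{transmit}(ms)$, $\mathbf{newpkt}(x,y)$, $\mathbf{deliver}(x)$), and $P+Q\leftrightarrow P'+Q'$; (b) if $(\xi,P)\leftrightarrow(\zeta,P')$ and $(\xi,Q)\leftrightarrow(\zeta,Q')$ then $(\xi,P+Q)\leftrightarrow(\zeta,P'+Q')$; and if $(\xi,P)\leftrightarrow(\zeta,P')$ and $\xi(x)=\zeta(x)$ (or both are undefined) then $(\xi,\mathbf{deliver}(x).P)\leftrightarrow(\zeta,\mathbf{deliver}(x).P')$; (c) if $(\xi,P)\leftrightarrow(\zeta,P')$ then $id{:}(\xi,P){:}R\leftrightarrow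 id{:}(\zeta,P'){:}R$; (d) if $M\leftrightarrow M'$ and $N\leftrightarrow N'$ then $M\|N\leftrightarrow M'\|N'$; and if $M\leftrightarrow M'$ then $[M]\leftrightarrow[M']$. (A process call $X(e_1,\dots,e_n)$ has no process operands, so for it the congruence property is reflexivity.) -/

import Mathlib

universe u

namespace LinkLayer

/-! ## Labelled transition systems and strong bisimilarity -/

/-- `R` is a strong bisimulation on the labelled transition system `step`. -/
def IsBisimulation {S A : Type*} (step : S → A → S → Prop) (R : S → S → Prop) : Prop :=
  ∀ s t, R s t →
    (∀ a s', step s a s' → ∃ t', step t a t' ∧ R s' t') ∧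
    (∀ a t', step t a t' → ∃ s', step s a s' ∧ R s' t')

/-- Strong bisimilarity: two states are related by some strong bisimulation. -/
def Bisimilar {S A : Type*} (step : S → A → S → Prop) (s t : S) : Prop :=
  ∃ R : S → S → Prop, IsBisimulation step R ∧ R s t

/-! ## Data -/

/-- The data types a specification can use: time, network layer data, messages, node identifiers,
sets of node identifiers, Booleans, and any further application-specific types `κ`.
(The type of chunks is defined below; specifications refer to it only through the Boolean
functions `new` and `idle`.) -/
inductive Ty (κ : Type u) : Type u
  | time
  | data
  | msg
  | ip
  | ipset
  | bool
  | extra (k : κ)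

/-- The carriers of the data types, and the duration of messages. -/
structure DataTypes where
  /-- network layer data -/
  DATA : Type u
  /-- messages -/
  MSG : Type u
  /-- node identifiers -/
  IP : Type u
  /-- number of chunks (= number of time units) needed to send a message -/
  dur : MSG → ℕ
  dur_pos : ∀ m, 0 < dur m
  /-- names of further types -/
  Extra : Type u
  /-- values of the further types -/
  ExtraVal : Extra → Type u

/-- The values of each type. Time values are integers. -/
def DataTypes.Val (Δ : DataTypes.{u}) : Ty Δ.Extra → Type u
  | .time => ULift.{u} ℤ
  | .data => Δ.DATA
  | .msg => Δ.MSG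
  | .ip => Δ.IP
  | .ipset => Set Δ.IP
  | .bool => ULift.{u} Bool
  | .extra k => Δ.ExtraVal k

/-- A data structure: types, typed variables (besides the special variables), operators and
predicates. Operators may be partial. -/
structure DataStructure extends DataTypes.{u} where
  /-- the data variables of each type, besides `now`, `rfr` and `cntr` -/
  Var : Ty Extra → Type u
  /-- operator symbols, their arities, argument types, result types and meaning -/
  Op : Type u
  opArity : Op → ℕ
  opDom : (f : Op) → Fin (opArity f) → Ty Extra
  opCod : Op → Ty Extra
  opVal : (f : Op) → ((i : Fin (opArity f)) → toDataTypes.Val (opDom f i)) →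
    Option (toDataTypes.Val (opCod f))
  /-- predicate symbols, their arities, argument types and meaning -/
  Pred : Type u
  predArity : Pred → ℕ
  predDom : (p : Pred) → Fin (predArity p) → Ty Extra
  predVal : (p : Pred) → ((i : Fin (predArity p)) → toDataTypes.Val (predDom p i)) → Prop

/-- The fragment `msg : idx` of a message, with `1 ≤ idx ≤ dur msg`. -/
structure Fragment (D : DataStructure.{u}) where
  msg : D.MSG
  idx : ℕ
  one_le : 1 ≤ idx
  le_dur : idx ≤ D.dur msg

/-- Chunks: a fragment of a message, a conflict, or an idle medium. -/
inductive Chunk (D : DataStructure.{u}) : Type u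
  | frag (f : Fragment D)
  | conflict
  | idle

open Classical in
/-- `rfr ⋆ ch`: the update of the chunk register `rfr` upon receipt of the chunk `ch`. -/
noncomputable def Chunk.star {D : DataStructure.{u}} (rfr : Chunk D) : Chunk D → Chunk D
  | .conflict => .conflict
  | .idle => .idle
  | .frag f =>
      if f.idx = 1 ∨ ∃ g : Fragment D, rfr = .frag g ∧ g.msg = f.msg ∧ g.idx + 1 = f.idx
      then .frag f else .conflict

/-- The variables that may occur in specifications: the clock `now` and the data variables. -/
inductive SpecVar (D : DataStructure.{u}) : Ty D.Extra → Type u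
  | now : SpecVar D .time
  | loc {t : Ty D.Extra} (x : D.Var t) : SpecVar D t

/-- A valuation: the special variables `now`, `rfr`, `cntr` always have a value, the data
variables need not have one. -/
structure Valuation (D : DataStructure.{u}) where
  now : ℤ
  rfr : Chunk D
  cntr : ℕ
  loc : (p : Σ t, D.Var t) → Option (D.Val p.1)

namespace Valuation

variable {D : DataStructure.{u}}

/-- `ξ(x)`. -/
def get (ξ : Valuation D) : {t : Ty D.Extra} → SpecVar D t → Option (D.Val t)
  | _, .now => some (ULift.up ξ.now)
  | _, .loc x => ξ.loc ⟨_, x⟩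

open Classical in
/-- `ξ[x := v]`. -/
noncomputable def set (ξ : Valuation D) :
    {t : Ty D.Extra} → SpecVar D t → D.Val t → Valuation D
  | _, .now, v => { ξ with now := ULift.down v }
  | t, .loc x, v => { ξ with loc := Function.update ξ.loc ⟨t, x⟩ (some v) }

/-- Restriction of `ξ` to the read-only variables `now`, `rfr` and `cntr`. -/
def readOnly (ξ : Valuation D) : Valuation D := { ξ with loc := fun _ => none }

/-- `ξ[rfr := rfr ⋆ ch, now++]`: one time unit passes, in which the chunk `ch` is received. -/
noncomputable def tick (ξ : Valuation D) (ch : Chunk D) : Valuation D :=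
  { ξ with rfr := ξ.rfr.star ch, now := ξ.now + 1 }

end Valuation

/-- Data expressions. Values are expressions denoting themselves. -/
inductive Expr (D : DataStructure.{u}) : Ty D.Extra → Type u
  | var {t : Ty D.Extra} (x : SpecVar D t) : Expr D t
  | const {t : Ty D.Extra} (v : D.Val t) : Expr D t
  | op (f : D.Op) (args : (i : Fin (D.opArity f)) → Expr D (D.opDom f i)) : Expr D (D.opCod f)
  | new (m : Expr D .msg) : Expr D .bool
  | idle : Expr D .bool

namespace Expr

variable {D : DataStructure.{u}}

open Classical in
/-- `ξ(e)`, which is `none` if undefined. `new(m)` says that the last chunk of `m` has just been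
received in order, `idle` that the medium was idle during the last time unit. -/
noncomputable def eval (ξ : Valuation D) : {t : Ty D.Extra} → Expr D t → Option (D.Val t)
  | _, .var x => ξ.get x
  | _, .const v => some v
  | _, .op f args =>
      if h : ∀ i, (eval ξ (args i)).isSome then D.opVal f (fun i => (eval ξ (args i)).get (h i))
      else none
  | _, .new m =>
      (eval ξ m).map fun v =>
        ULift.up (decide (ξ.rfr = .frag ⟨v, D.dur v, D.dur_pos v, le_refl _⟩))
  | _, .idle => some (ULift.up (decide (ξ.rfr = .idle)))

/-- The variables occurring in an expression. -/
def vars : {t : Ty D.Extra} → Expr D t → Set (Σ t, SpecVar D t)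
  | t, .var x => {⟨t, x⟩}
  | _, .const _ => ∅
  | _, .op _ args => ⋃ i, vars (args i)
  | _, .new m => vars m
  | _, .idle => ∅

end Expr

/-- Data formulas: first-order predicate logic (the other connectives and the existential
quantifier are definable). -/
inductive Formula (D : DataStructure.{u}) : Type u
  | isTrue (b : Expr D .bool)
  | pred (p : D.Pred) (args : (i : Fin (D.predArity p)) → Expr D (D.predDom p i))
  | eq {t : Ty D.Extra} (e₁ e₂ : Expr D t)
  | neg (φ : Formula D)
  | and (φ ψ : Formula D)
  | all {t : Ty D.Extra} (x : SpecVar D t) (φ : Formula D)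

namespace Formula

variable {D : DataStructure.{u}}

/-- Truth of a formula under a valuation; atomic formulas with an undefined argument are false. -/
def Holds : Formula D → Valuation D → Prop
  | .isTrue b, ξ => b.eval ξ = some (ULift.up true)
  | .pred p args, ξ => ∃ vs, (∀ i, (args i).eval ξ = some (vs i)) ∧ D.predVal p vs
  | .eq e₁ e₂, ξ => ∃ v, e₁.eval ξ = some v ∧ e₂.eval ξ = some v
  | .neg φ, ξ => ¬ φ.Holds ξ
  | .and φ ψ, ξ => φ.Holds ξ ∧ ψ.Holds ξ
  | .all x φ, ξ => ∀ v, φ.Holds (ξ.set x v)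

/-- The variables occurring free in a formula. -/
def free : Formula D → Set (Σ t, SpecVar D t)
  | .isTrue b => b.vars
  | .pred _ args => ⋃ i, (args i).vars
  | .eq e₁ e₂ => e₁.vars ∪ e₂.vars
  | .neg φ => φ.free
  | .and φ ψ => φ.free ∪ ψ.free
  | .all (t := t) x φ => φ.free \ {⟨t, x⟩}

/-- `ξ —φ→ ζ`: the valuation `ζ` extends `ξ`, is defined in addition precisely on the variables
free in `φ`, and satisfies `φ`. -/
def Sat (φ : Formula D) (ξ ζ : Valuation D) : Prop :=
  ζ.now = ξ.now ∧ ζ.rfr = ξ.rfr ∧ ζ.cntr = ξ.cntr ∧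
  (∀ p v, ξ.loc p = some v → ζ.loc p = some v) ∧
  (∀ p : Σ t, D.Var t, (ζ.loc p).isSome ↔
    (ξ.loc p).isSome ∨ (⟨p.1, .loc p.2⟩ : Σ t, SpecVar D t) ∈ φ.free) ∧
  φ.Holds ζ

end Formula

/-! ## Sequential processes -/

/-- Process names with their formal parameters. -/
structure ProcNames (D : DataStructure.{u}) where
  Name : Type u
  arity : Name → ℕ
  param : (X : Name) → Fin (arity X) → Σ t, SpecVar D t

/-- Sequential process expressions. -/
inductive SP (D : DataStructure.{u}) (N : ProcNames D) : Type u
  /-- `X(exp₁, …, expₙ)` -/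
  | call (X : N.Name) (args : (i : Fin (N.arity X)) → Expr D (N.param X i).1)
  /-- `[φ] P` -/
  | guard (φ : Formula D) (P : SP D N)
  /-- `⟦var := exp⟧ P` -/
  | assign {t : Ty D.Extra} (x : SpecVar D t) (e : Expr D t) (P : SP D N)
  /-- `transmit(ms).P` -/
  | transmit (ms : Expr D .msg) (P : SP D N)
  /-- `newpkt(data, dest).P` -/
  | newpkt (data : SpecVar D .data) (dest : SpecVar D .ip) (P : SP D N)
  /-- `deliver(data).P` -/
  | deliver (data : SpecVar D .data) (P : SP D N)
  /-- `P + Q` -/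
  | choice (P Q : SP D N)

/-- A specification: process names, each with a defining equation `X(var₁, …, varₙ) = body X`. -/
structure Spec (D : DataStructure.{u}) extends ProcNames D where
  body : Name → SP D toProcNames

/-- Actions of sequential processes. -/
inductive SeqAct (D : DataStructure.{u}) : Type u
  /-- transmit a fragment, and receive the chunk `ch` at the same time -/
  | transmit (f : Fragment D) (ch : Chunk D)
  /-- wait one time unit, and receive the chunk `ch` -/
  | wait (ch : Chunk D)
  | newpkt (d : D.DATA) (dest : D.IP)
  | deliver (d : D.DATA)
  | tau

/-- The valuation `ξ|{now,rfr,cntr} [varᵢ := vᵢ]ᵢ` in which the body of `X` is run. -/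
noncomputable def callValuation {D : DataStructure.{u}} {N : ProcNames D} (ξ : Valuation D)
    (X : N.Name) (vs : (i : Fin (N.arity X)) → D.Val (N.param X i).1) : Valuation D :=
  (List.finRange (N.arity X)).foldl (fun ζ i => ζ.set (N.param X i).2 (vs i)) ξ.readOnly

/-- `ξ(P)↑`: some data expression needed for the first step of `P` has no value. -/
def Unvalued {D : DataStructure.{u}} {N : ProcNames D} (ξ : Valuation D) : SP D N → Prop
  | .call _ args => ∃ i, (args i).eval ξ = none
  | .guard _ _ => False
  | .assign _ e _ => e.eval ξ = none
  | .transmit ms _ => ms.eval ξ = none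
  | .newpkt _ _ _ => False
  | .deliver x _ => ξ.get x = none
  | .choice _ _ => False

/-- States of sequential processes: a valuation and a sequential process expression. -/
abbrev SeqState (D : DataStructure.{u}) (N : ProcNames D) := Valuation D × SP D N

/-- Structural operational semantics of sequential processes. -/
inductive SeqStep {D : DataStructure.{u}} (E : Spec D) :
    SeqState D E.toProcNames → SeqAct D → SeqState D E.toProcNames → Prop
  | transmit_more {ξ : Valuation D} {ms : Expr D .msg} {P} {m : D.MSG}
      (hm : ms.eval ξ = some m) (hc : ξ.cntr + 1 < D.dur m) (ch : Chunk D) :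
      SeqStep E (ξ, .transmit ms P)
        (.transmit ⟨m, ξ.cntr + 1, Nat.le_add_left 1 ξ.cntr, le_of_lt hc⟩ ch)
        ({ ξ.tick ch with cntr := ξ.cntr + 1 }, .transmit (.const (t := .msg) m) P)
  | transmit_last {ξ : Valuation D} {ms : Expr D .msg} {P} {m : D.MSG}
      (hm : ms.eval ξ = some m) (hc : ξ.cntr + 1 = D.dur m) (ch : Chunk D) :
      SeqStep E (ξ, .transmit ms P)
        (.transmit ⟨m, ξ.cntr + 1, Nat.le_add_left 1 ξ.cntr, le_of_eq hc⟩ ch)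
        ({ ξ.tick ch with cntr := 0 }, P)
  | newpkt {ξ : Valuation D} {x : SpecVar D .data} {y : SpecVar D .ip} {P}
      (d : D.DATA) (dest : D.IP) :
      SeqStep E (ξ, .newpkt x y P) (.newpkt d dest) ((ξ.set x d).set y dest, P)
  | newpkt_wait {ξ : Valuation D} {x : SpecVar D .data} {y : SpecVar D .ip} {P} (ch : Chunk D) :
      SeqStep E (ξ, .newpkt x y P) (.wait ch) (ξ.tick ch, .newpkt x y P)
  | deliver {ξ : Valuation D} {x : SpecVar D .data} {P} {d : D.DATA} (hd : ξ.get x = some d) :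
      SeqStep E (ξ, .deliver x P) (.deliver d) (ξ, P)
  | assign {ξ : Valuation D} {t : Ty D.Extra} {x : SpecVar D t} {e : Expr D t} {P} {v : D.Val t}
      (hv : e.eval ξ = some v) :
      SeqStep E (ξ, .assign x e P) .tau (ξ.set x v, P)
  | call {ξ : Valuation D} {X : E.Name} {args} {vs} {a : SeqAct D} {s}
      (hvs : ∀ i, (args i).eval ξ = some (vs i)) (ha : ∀ ch, a ≠ .wait ch)
      (h : SeqStep E (callValuation ξ X vs, E.body X) a s) :
      SeqStep E (ξ, .call X args) a s
  | call_wait {ξ : Valuation D} {X : E.Name} {args} {vs} {ch : Chunk D} {s}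
      (hvs : ∀ i, (args i).eval ξ = some (vs i))
      (h : SeqStep E (callValuation ξ X vs, E.body X) (.wait ch) s) :
      SeqStep E (ξ, .call X args) (.wait ch) (ξ.tick ch, .call X args)
  | unvalued {ξ : Valuation D} {P} (h : Unvalued ξ P) (ch : Chunk D) :
      SeqStep E (ξ, P) (.wait ch) (ξ.tick ch, P)
  | choice_left {ξ : Valuation D} {P Q} {a : SeqAct D} {s} (ha : ∀ ch, a ≠ .wait ch)
      (h : SeqStep E (ξ, P) a s) : SeqStep E (ξ, .choice P Q) a s
  | choice_right {ξ : Valuation D} {P Q} {a : SeqAct D} {s} (ha : ∀ ch, a ≠ .wait ch)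
      (h : SeqStep E (ξ, Q) a s) : SeqStep E (ξ, .choice P Q) a s
  | choice_wait {ξ ζ ζ' : Valuation D} {P Q P' Q'} {ch : Chunk D}
      (hP : SeqStep E (ξ, P) (.wait ch) (ζ, P')) (hQ : SeqStep E (ξ, Q) (.wait ch) (ζ', Q')) :
      SeqStep E (ξ, .choice P Q) (.wait ch) (ζ, .choice P' Q')
  | guard {ξ ζ : Valuation D} {φ : Formula D} {P} (h : φ.Sat ξ ζ) :
      SeqStep E (ξ, .guard φ P) .tau (ζ, P)
  | guard_wait {ξ : Valuation D} {φ : Formula D} {P} (h : ∀ ζ, ¬ φ.Sat ξ ζ) (ch : Chunk D) :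
      SeqStep E (ξ, .guard φ P) (.wait ch) (ξ.tick ch, .guard φ P)

/-- Strong bisimilarity of sequential process expressions: bisimilarity of the corresponding
states under every valuation. -/
def SeqBisimilar {D : DataStructure.{u}} (E : Spec D) (P Q : SP D E.toProcNames) : Prop :=
  ∀ ξ : Valuation D, Bisimilar (SeqStep E) (ξ, P) (ξ, Q)

/-! ## Networks -/

/-- Partial networks: parallel compositions of node expressions `id : (ξ, P) : R`. -/
inductive PartialNet (D : DataStructure.{u}) (N : ProcNames D) : Type u
  | node (id : D.IP) (s : SeqState D N) (R : Set D.IP)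
  | par (M₁ M₂ : PartialNet D N)

/-- Complete networks: encapsulated partial networks `[M]`. -/
inductive CompleteNet (D : DataStructure.{u}) (N : ProcNames D) : Type u
  | encap (M : PartialNet D N)

/-- The grammar of partial networks: `Grammar T S M` says that `M` describes the nodes in `S`, as
part of a complete network whose nodes are those in `T`. The well-formed complete networks
are the `[M]` with `Grammar T T M`. -/
inductive PartialNet.Grammar {D : DataStructure.{u}} {N : ProcNames D} (T : Set D.IP) :
    Set D.IP → PartialNet D N → Prop
  | node {id : D.IP} {s : SeqState D N} {R : Set D.IP} (hid : id ∈ T) (hR : R ⊆ T) :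
      Grammar T {id} (.node id s R)
  | par {S₁ S₂ : Set D.IP} {M₁ M₂ : PartialNet D N} (h : Disjoint S₁ S₂)
      (h₁ : Grammar T S₁ M₁) (h₂ : Grammar T S₂ M₂) : Grammar T (S₁ ∪ S₂) (.par M₁ M₂)

/-- Labels of network transitions. In `traffic T R`, the partial function `T` gives the chunks
sent to each identifier and `R` the chunks received at each identifier. -/
inductive NetAct (D : DataStructure.{u}) : Type u
  | traffic (T R : D.IP → Option (Chunk D))
  | deliver (id : D.IP) (d : D.DATA)
  | newpkt (id : D.IP) (d : D.DATA) (dest : D.IP)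
  | connect (id id' : D.IP)
  | disconnect (id id' : D.IP)
  | tau
  | tick

/-- The actions that are interleaved in a parallel composition. -/
def NetAct.Interleaved {D : DataStructure.{u}} : NetAct D → Prop
  | .tau => True
  | .deliver _ _ => True
  | .newpkt _ _ _ => True
  | _ => False

/-- The actions that change the topology; these are synchronised in a parallel composition. -/
def NetAct.Topology {D : DataStructure.{u}} : NetAct D → Prop
  | .connect _ _ => True
  | .disconnect _ _ => True
  | _ => False

section PartialFunctions

variable {D : DataStructure.{u}}

/-- Union of partial functions, with a conflict wherever both are defined. -/
def uplus (f g : D.IP → Option (Chunk D)) : D.IP → Option (Chunk D) := fun id =>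
  match f id, g id with
  | none, r => r
  | some ch, none => some ch
  | some _, some _ => some .conflict

open Classical in
/-- The partial function `{(r, f) | r ∈ R}`. -/
noncomputable def sendTo (R : Set D.IP) (f : Fragment D) : D.IP → Option (Chunk D) := fun r =>
  if r ∈ R then some (.frag f) else none

open Classical in
/-- The partial function `{(id, ch)}`, or `∅` if `ch` is `idle`. -/
noncomputable def receiveAt (id : D.IP) (ch : Chunk D) : D.IP → Option (Chunk D) := fun r =>
  if r = id ∧ ch ≠ .idle then some ch else none

end PartialFunctions

/-- Structural operational semantics of node expressions and partial networks. A node can be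
connected only to identifiers in `T`, the set of all nodes of the complete network, so that the
range of a node stays within `T`; the choice `T = Set.univ` lifts this restriction. -/
inductive NetStep {D : DataStructure.{u}} (E : Spec D) (T : Set D.IP) :
    PartialNet D E.toProcNames → NetAct D → PartialNet D E.toProcNames → Prop
  | wait {id : D.IP} {s s'} {R : Set D.IP} {ch : Chunk D} (h : SeqStep E s (.wait ch) s') :
      NetStep E T (.node id s R) (.traffic (fun _ => none) (receiveAt id ch)) (.node id s' R)
  | transmit {id : D.IP} {s s'} {R : Set D.IP} {f : Fragment D} {ch : Chunk D}
      (h : SeqStep E s (.transmit f ch) s') :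
      NetStep E T (.node id s R) (.traffic (sendTo R f) (receiveAt id ch)) (.node id s' R)
  | deliver {id : D.IP} {s s'} {R : Set D.IP} {d : D.DATA} (h : SeqStep E s (.deliver d) s') :
      NetStep E T (.node id s R) (.deliver id d) (.node id s' R)
  | newpkt {id : D.IP} {s s'} {R : Set D.IP} {d : D.DATA} {dest : D.IP}
      (h : SeqStep E s (.newpkt d dest) s') :
      NetStep E T (.node id s R) (.newpkt id d dest) (.node id s' R)
  | tau {id : D.IP} {s s'} {R : Set D.IP} (h : SeqStep E s .tau s') :
      NetStep E T (.node id s R) .tau (.node id s' R)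
  | connect_to {id id' : D.IP} {s} {R : Set D.IP} (hT : id' ∈ T) :
      NetStep E T (.node id s R) (.connect id id') (.node id s (R ∪ {id'}))
  | disconnect_to {id id' : D.IP} {s} {R : Set D.IP} :
      NetStep E T (.node id s R) (.disconnect id id') (.node id s (R \ {id'}))
  | connect_from {id id' : D.IP} {s} {R : Set D.IP} (hT : id' ∈ T) :
      NetStep E T (.node id s R) (.connect id' id) (.node id s (R ∪ {id'}))
  | disconnect_from {id id' : D.IP} {s} {R : Set D.IP} :
      NetStep E T (.node id s R) (.disconnect id' id) (.node id s (R \ {id'}))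
  | connect_other {id id' id'' : D.IP} {s} {R : Set D.IP} (h' : id ≠ id') (h'' : id ≠ id'') :
      NetStep E T (.node id s R) (.connect id' id'') (.node id s R)
  | disconnect_other {id id' id'' : D.IP} {s} {R : Set D.IP} (h' : id ≠ id') (h'' : id ≠ id'') :
      NetStep E T (.node id s R) (.disconnect id' id'') (.node id s R)
  | par_left {M M' N} {a : NetAct D} (ha : a.Interleaved) (h : NetStep E T M a M') :
      NetStep E T (.par M N) a (.par M' N)
  | par_right {M N N'} {a : NetAct D} (ha : a.Interleaved) (h : NetStep E T N a N') :
      NetStep E T (.par M N) a (.par M N')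
  | par_topology {M M' N N'} {a : NetAct D} (ha : a.Topology)
      (hM : NetStep E T M a M') (hN : NetStep E T N a N') :
      NetStep E T (.par M N) a (.par M' N')
  | par_traffic {M M' N N'} {T₁ R₁ T₂ R₂ : D.IP → Option (Chunk D)}
      (hM : NetStep E T M (.traffic T₁ R₁) M') (hN : NetStep E T N (.traffic T₂ R₂) N') :
      NetStep E T (.par M N) (.traffic (uplus T₁ T₂) (uplus R₁ R₂)) (.par M' N')

/-- Structural operational semantics of complete networks. -/
inductive CompleteStep {D : DataStructure.{u}} (E : Spec D) (T : Set D.IP) :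
    CompleteNet D E.toProcNames → NetAct D → CompleteNet D E.toProcNames → Prop
  | interleaved {M M'} {a : NetAct D} (ha : a.Interleaved) (h : NetStep E T M a M') :
      CompleteStep E T (.encap M) a (.encap M')
  | topology {M M'} {a : NetAct D} (ha : a.Topology) (h : NetStep E T M a M') :
      CompleteStep E T (.encap M) a (.encap M')
  | tick {M M'} {R : D.IP → Option (Chunk D)} (h : NetStep E T M (.traffic R R) M') :
      CompleteStep E T (.encap M) .tick (.encap M')

/-- The grammar is closed under transitions. -/
theorem PartialNet.Grammar.step {D : DataStructure.{u}} {E : Spec D} {T : Set D.IP}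
    {S : Set D.IP} {M M' : PartialNet D E.toProcNames} {a : NetAct D}
    (hM : Grammar T S M) (h : NetStep E T M a M') : Grammar T S M' := by
  induction h generalizing S with
  | connect_to hT =>
    cases hM with
    | node hid hR => exact .node hid (Set.union_subset hR (by simpa using hT))
  | connect_from hT =>
    cases hM with
    | node hid hR => exact .node hid (Set.union_subset hR (by simpa using hT))
  | disconnect_to => cases hM with | node hid hR => exact .node hid (Set.sdiff_subset.trans hR)
  | disconnect_from => cases hM with | node hid hR => exact .node hid (Set.sdiff_subset.trans hR)
  | par_left _ _ ih => cases hM with | par h h₁ h₂ => exact .par h (ih h₁) h₂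
  | par_right _ _ ih => cases hM with | par h h₁ h₂ => exact .par h h₁ (ih h₂)
  | par_topology _ _ _ ih ih' => cases hM with | par h h₁ h₂ => exact .par h (ih h₁) (ih' h₂)
  | par_traffic _ _ ih ih' => cases hM with | par h h₁ h₂ => exact .par h (ih h₁) (ih' h₂)
  | _ => cases hM with | node hid hR => exact .node hid hR

end LinkLayer

/-! For each operator, take the symmetric relation pairing two terms that have this outermost
operator and related operands. A step of one term is derived from steps of its operands, or from
data alone, and the other term has a step with the same label. Afterwards either the operator is
still there and the targets are again related, or it has been consumed and the targets are bisimilar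
by hypothesis. `Bisimilar.of_symmetric` turns this one-sided check into bisimilarity.

The delicate points concern valuations. Guards, assignments, `transmit` and `newpkt` may run their
operand in a changed valuation, so their operands must be bisimilar under every valuation. For
`choice`, the waiting rule keeps only the left valuation; by `SeqStep.eq_of_wait` the right one is
the same. For `deliver`, waiting changes the valuation, but it happens only if the variable is
undefined, and by `Valuation.get_tick_data` it then stays undefined, so the operand never runs. -/

namespace LinkLayer

/-! ### Bisimilarity on an arbitrary labelled transition system. -/

section Bisimulation

variable {S A : Type*} {step : S → A → S → Prop}

theorem Bisimilar.refl (s : S) : Bisimilar step s s := by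
  refine ⟨Eq, ?_, rfl⟩
  rintro s _ rfl
  exact ⟨fun a s' h => ⟨s', h, rfl⟩, fun a s' h => ⟨s', h, rfl⟩⟩

theorem Bisimilar.symm {s t : S} (h : Bisimilar step s t) : Bisimilar step t s := by
  obtain ⟨R, hR, hst⟩ := h
  exact ⟨fun x y => R y x, fun x y hxy => ⟨(hR y x hxy).2, (hR y x hxy).1⟩, hst⟩

/-- The bisimulation that witnesses `h` also relates the targets. All later proofs use bisimilarity
of operands through this transfer property. -/
theorem Bisimilar.exists_step {s t : S} (h : Bisimilar step s t) {a : A} {s' : S}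
    (hs : step s a s') : ∃ t', step t a t' ∧ Bisimilar step s' t' := by
  obtain ⟨R, hR, hst⟩ := h
  obtain ⟨t', ht, hst'⟩ := (hR s t hst).1 a s' hs
  exact ⟨t', ht, R, hR, hst'⟩

/-- A symmetric relation that is a simulation up to inclusion in bisimilarity is contained in
bisimilarity. -/
theorem Bisimilar.of_symmetric (R : S → S → Prop) (hsymm : ∀ s t, R s t → R t s)
    (hstep : ∀ s t, R s t → ∀ a s', step s a s' →
      ∃ t', step t a t' ∧ (R s' t' ∨ Bisimilar step s' t'))
    {s t : S} (h : R s t) : Bisimilar step s t := by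
  have key : ∀ s t, (R s t ∨ Bisimilar step s t) → ∀ a s', step s a s' →
      ∃ t', step t a t' ∧ (R s' t' ∨ Bisimilar step s' t') := by
    rintro s t (h | h) a s' hs
    · exact hstep s t h a s' hs
    · obtain ⟨t', ht, hb⟩ := h.exists_step hs
      exact ⟨t', ht, .inr hb⟩
  -- The union of `R` with bisimilarity is itself symmetric, so the backward clause is `key` with
  -- the roles exchanged.
  refine ⟨fun s t => R s t ∨ Bisimilar step s t, fun s t hst => ⟨key s t hst, ?_⟩, .inl h⟩
  intro a t' ht
  obtain ⟨s', hs, h'⟩ := key t s (hst.imp (hsymm s t) .symm) a t' ht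
  exact ⟨s', hs, h'.imp (hsymm t' s') .symm⟩

theorem Bisimilar.trans {s t u : S} (hst : Bisimilar step s t) (htu : Bisimilar step t u) :
    Bisimilar step s u := by
  refine of_symmetric (fun x z => ∃ y, Bisimilar step x y ∧ Bisimilar step y z) ?_ ?_ ⟨t, hst, htu⟩
  · rintro x z ⟨y, h, h'⟩
    exact ⟨y, h'.symm, h.symm⟩
  · rintro x z ⟨y, h, h'⟩ a x' hx
    obtain ⟨y', hy, hb⟩ := h.exists_step hx
    obtain ⟨z', hz, hb'⟩ := h'.exists_step hy
    exact ⟨z', hz, .inl ⟨y', hb, hb'⟩⟩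

theorem Bisimilar.equivalence (step : S → A → S → Prop) : Equivalence (Bisimilar step) :=
  ⟨refl, symm, trans⟩

end Bisimulation

/-! ### Congruence for the operators on sequential processes. -/

section Sequential

variable {D : DataStructure.{u}} {E : Spec D}

theorem SeqBisimilar.symm {P Q : SP D E.toProcNames} (h : SeqBisimilar E P Q) :
    SeqBisimilar E Q P := fun ξ => (h ξ).symm

theorem SeqBisimilar.equivalence (E : Spec D) : Equivalence (SeqBisimilar E) :=
  ⟨fun _ _ => .refl _, .symm, fun h h' ξ => (h ξ).trans (h' ξ)⟩

/-- Waiting only lets time pass: it does not change the process expression. -/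
theorem SeqStep.eq_of_wait {s s' : SeqState D E.toProcNames} {ch : Chunk D}
    (h : SeqStep E s (.wait ch) s') : s' = (s.1.tick ch, s.2) := by
  generalize ha : SeqAct.wait ch = a at h
  induction h with
  -- These rules have the ticked valuation and the unchanged expression as target; a waiting call
  -- discards the state reached by its body.
  | newpkt_wait | unvalued | guard_wait | call_wait => cases ha; rfl
  | call _ hn | choice_left hn | choice_right hn => exact absurd ha.symm (hn ch)
  | choice_wait _ _ ihP ihQ =>
    cases ha
    have hP := ihP rfl
    have hQ := ihQ rfl
    simp only [Prod.mk.injEq] at hP hQ ⊢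
    exact ⟨hP.1, by rw [hP.2, hQ.2]⟩
  | _ => cases ha

/-- Whether some `ζ` satisfies the guard depends on `φ` and `ξ` only, so even the negative premise
of `guard_wait` transfers from `P` to `P'`. -/
theorem SeqBisimilar.guard (φ : Formula D) {P P' : SP D E.toProcNames}
    (h : SeqBisimilar E P P') : SeqBisimilar E (.guard φ P) (.guard φ P') := by
  intro ξ
  refine .of_symmetric (fun s t => ∃ ξ P P', SeqBisimilar E P P' ∧
    s = (ξ, .guard φ P) ∧ t = (ξ, .guard φ P')) ?_ ?_ ⟨ξ, P, P', h, rfl, rfl⟩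
  · rintro _ _ ⟨ξ, P, P', h, rfl, rfl⟩
    exact ⟨ξ, P', P, h.symm, rfl, rfl⟩
  · rintro _ _ ⟨ξ, P, P', h, rfl, rfl⟩ a s' hs
    cases hs with
    | unvalued hu => exact hu.elim
    | guard hφ => exact ⟨_, .guard hφ, .inr (h _)⟩
    | guard_wait hφ ch => exact ⟨_, .guard_wait hφ ch, .inl ⟨_, _, _, h, rfl, rfl⟩⟩

/-- Waiting changes `now` and `rfr`, which can make an undefined `e` defined; hence the relation
ranges over all `ξ`. -/
theorem SeqBisimilar.assign {t : Ty D.Extra} (x : SpecVar D t) (e : Expr D t)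
    {P P' : SP D E.toProcNames} (h : SeqBisimilar E P P') :
    SeqBisimilar E (.assign x e P) (.assign x e P') := by
  intro ξ
  refine .of_symmetric (fun s t => ∃ ξ P P', SeqBisimilar E P P' ∧
    s = (ξ, .assign x e P) ∧ t = (ξ, .assign x e P')) ?_ ?_ ⟨ξ, P, P', h, rfl, rfl⟩
  · rintro _ _ ⟨ξ, P, P', h, rfl, rfl⟩
    exact ⟨ξ, P', P, h.symm, rfl, rfl⟩
  · rintro _ _ ⟨ξ, P, P', h, rfl, rfl⟩ a s' hs
    cases hs with
    | unvalued hu ch =>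
      -- Unfolded, the premise no longer mentions `P`, so it serves for `P'` too.
      have hu : e.eval ξ = none := hu
      exact ⟨_, .unvalued (P := .assign x e P') hu ch, .inl ⟨_, _, _, h, rfl, rfl⟩⟩
    | assign hv => exact ⟨_, .assign hv, .inr (h _)⟩

theorem SeqBisimilar.transmit (ms : Expr D .msg) {P P' : SP D E.toProcNames}
    (h : SeqBisimilar E P P') : SeqBisimilar E (.transmit ms P) (.transmit ms P') := by
  intro ξ
  -- `ms` varies because a fragment other than the last replaces it by the constant message.
  refine .of_symmetric (fun s t => ∃ ξ ms P P', SeqBisimilar E P P' ∧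
    s = (ξ, .transmit ms P) ∧ t = (ξ, .transmit ms P')) ?_ ?_ ⟨ξ, ms, P, P', h, rfl, rfl⟩
  · rintro _ _ ⟨ξ, ms, P, P', h, rfl, rfl⟩
    exact ⟨ξ, ms, P', P, h.symm, rfl, rfl⟩
  · rintro _ _ ⟨ξ, ms, P, P', h, rfl, rfl⟩ a s' hs
    cases hs with
    | unvalued hu ch =>
      have hu : ms.eval ξ = none := hu
      exact ⟨_, .unvalued (P := .transmit ms P') hu ch, .inl ⟨_, _, _, _, h, rfl, rfl⟩⟩
    | transmit_more hm hc ch =>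
      exact ⟨_, .transmit_more hm hc ch, .inl ⟨_, _, _, _, h, rfl, rfl⟩⟩
    | transmit_last hm hc ch => exact ⟨_, .transmit_last hm hc ch, .inr (h _)⟩

theorem SeqBisimilar.newpkt (x : SpecVar D .data) (y : SpecVar D .ip)
    {P P' : SP D E.toProcNames} (h : SeqBisimilar E P P') :
    SeqBisimilar E (.newpkt x y P) (.newpkt x y P') := by
  intro ξ
  refine .of_symmetric (fun s t => ∃ ξ P P', SeqBisimilar E P P' ∧
    s = (ξ, .newpkt x y P) ∧ t = (ξ, .newpkt x y P')) ?_ ?_ ⟨ξ, P, P', h, rfl, rfl⟩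
  · rintro _ _ ⟨ξ, P, P', h, rfl, rfl⟩
    exact ⟨ξ, P', P, h.symm, rfl, rfl⟩
  · rintro _ _ ⟨ξ, P, P', h, rfl, rfl⟩ a s' hs
    cases hs with
    | unvalued hu => exact hu.elim
    | newpkt d dest => exact ⟨_, .newpkt d dest, .inr (h _)⟩
    | newpkt_wait ch => exact ⟨_, .newpkt_wait ch, .inl ⟨_, _, _, h, rfl, rfl⟩⟩

/-- The clock has type `time`, so a variable of type `data` is a local one, which a tick leaves
alone. -/
theorem Valuation.get_tick_data (ξ : Valuation D) (ch : Chunk D) (x : SpecVar D .data) :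
    (ξ.tick ch).get x = ξ.get x := by
  cases x
  rfl

theorem Bisimilar.deliver {ξ ζ : Valuation D} (x : SpecVar D .data) {P P' : SP D E.toProcNames}
    (hx : ξ.get x = ζ.get x) (h : Bisimilar (SeqStep E) (ξ, P) (ζ, P')) :
    Bisimilar (SeqStep E) (ξ, .deliver x P) (ζ, .deliver x P') := by
  refine .of_symmetric (fun s t => ∃ ξ ζ P P', ξ.get x = ζ.get x ∧
    -- Bisimilarity of the operands need not survive a tick of both valuations, so it is demanded
    -- only where `deliver` can fire.
    (ξ.get x ≠ none → Bisimilar (SeqStep E) (ξ, P) (ζ, P')) ∧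
    s = (ξ, .deliver x P) ∧ t = (ζ, .deliver x P')) ?_ ?_
    ⟨ξ, ζ, P, P', hx, fun _ => h, rfl, rfl⟩
  · rintro _ _ ⟨ξ, ζ, P, P', hx, h, rfl, rfl⟩
    exact ⟨ζ, ξ, P', P, hx.symm, fun hd => (h (hx ▸ hd)).symm, rfl, rfl⟩
  · rintro _ _ ⟨ξ, ζ, P, P', hx, h, rfl, rfl⟩ a s' hs
    cases hs with
    | deliver hd => exact ⟨_, .deliver (hx ▸ hd), .inr (h (hd ▸ Option.some_ne_none _))⟩
    | unvalued hu ch =>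
      have hu : ξ.get x = none := hu
      have hu' : ζ.get x = none := hx ▸ hu
      exact ⟨_, .unvalued (P := .deliver x P') hu' ch, .inl ⟨_, _, _, _,
        by rw [Valuation.get_tick_data, Valuation.get_tick_data, hx],
        fun hd => absurd ((Valuation.get_tick_data ξ ch x).trans hu) hd, rfl, rfl⟩⟩

theorem Bisimilar.choice {ξ ζ : Valuation D} {P P' Q Q' : SP D E.toProcNames}
    (hP : Bisimilar (SeqStep E) (ξ, P) (ζ, P')) (hQ : Bisimilar (SeqStep E) (ξ, Q) (ζ, Q')) :
    Bisimilar (SeqStep E) (ξ, .choice P Q) (ζ, .choice P' Q') := by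
  refine .of_symmetric (fun s t => ∃ ξ ζ P P' Q Q', Bisimilar (SeqStep E) (ξ, P) (ζ, P') ∧
    Bisimilar (SeqStep E) (ξ, Q) (ζ, Q') ∧ s = (ξ, .choice P Q) ∧ t = (ζ, .choice P' Q')) ?_ ?_
    ⟨ξ, ζ, P, P', Q, Q', hP, hQ, rfl, rfl⟩
  · rintro _ _ ⟨ξ, ζ, P, P', Q, Q', hP, hQ, rfl, rfl⟩
    exact ⟨ζ, ξ, P', P, Q', Q, hP.symm, hQ.symm, rfl, rfl⟩
  · rintro _ _ ⟨ξ, ζ, P, P', Q, Q', hP, hQ, rfl, rfl⟩ a s' hs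
    cases hs with
    | unvalued hu => exact hu.elim
    | choice_left ha h =>
      obtain ⟨t', ht, hb⟩ := hP.exists_step h
      exact ⟨t', .choice_left ha ht, .inr hb⟩
    | choice_right ha h =>
      obtain ⟨t', ht, hb⟩ := hQ.exists_step h
      exact ⟨t', .choice_right ha ht, .inr hb⟩
    | choice_wait h₁ h₂ =>
      obtain ⟨⟨ζ₁, P₁⟩, ht₁, hb₁⟩ := hP.exists_step h₁
      obtain ⟨⟨ζ₂, Q₂⟩, ht₂, hb₂⟩ := hQ.exists_step h₂
      -- `hb₂` speaks of the valuations reached by the right summands, whereas the targets carry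
      -- those of the left summands. On each side both are the tick of the common source valuation.
      refine ⟨_, .choice_wait ht₁ ht₂, .inl ⟨_, _, _, _, _, _, hb₁, ?_, rfl, rfl⟩⟩
      have e₁ := congrArg Prod.fst h₁.eq_of_wait
      have e₂ := congrArg Prod.fst h₂.eq_of_wait
      have e₃ := congrArg Prod.fst ht₁.eq_of_wait
      have e₄ := congrArg Prod.fst ht₂.eq_of_wait
      simp only at e₁ e₂ e₃ e₄
      rw [e₁, e₃]
      rwa [e₂, e₄] at hb₂

end Sequential

/-! ### Congruence for nodes, parallel composition and encapsulation. -/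

section Networks

variable {D : DataStructure.{u}} {E : Spec D} {T : Set D.IP}

theorem Bisimilar.node (id : D.IP) (R : Set D.IP) {s s' : SeqState D E.toProcNames}
    (h : Bisimilar (SeqStep E) s s') :
    Bisimilar (NetStep E T) (.node id s R) (.node id s' R) := by
  -- The range varies because connections change it, while `id` never changes. Such topology steps
  -- do not inspect the sequential state.
  refine .of_symmetric (fun M N => ∃ R s s', Bisimilar (SeqStep E) s s' ∧
    M = .node id s R ∧ N = .node id s' R) ?_ ?_ ⟨R, s, s', h, rfl, rfl⟩
  · rintro _ _ ⟨R, s, s', h, rfl, rfl⟩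
    exact ⟨R, s', s, h.symm, rfl, rfl⟩
  · rintro _ _ ⟨R, s, s', h, rfl, rfl⟩ a M' hM
    cases hM with
    | wait hs =>
      obtain ⟨t', ht, hb⟩ := h.exists_step hs
      exact ⟨_, .wait ht, .inl ⟨_, _, _, hb, rfl, rfl⟩⟩
    | transmit hs =>
      obtain ⟨t', ht, hb⟩ := h.exists_step hs
      exact ⟨_, .transmit ht, .inl ⟨_, _, _, hb, rfl, rfl⟩⟩
    | deliver hs =>
      obtain ⟨t', ht, hb⟩ := h.exists_step hs
      exact ⟨_, .deliver ht, .inl ⟨_, _, _, hb, rfl, rfl⟩⟩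
    | newpkt hs =>
      obtain ⟨t', ht, hb⟩ := h.exists_step hs
      exact ⟨_, .newpkt ht, .inl ⟨_, _, _, hb, rfl, rfl⟩⟩
    | tau hs =>
      obtain ⟨t', ht, hb⟩ := h.exists_step hs
      exact ⟨_, .tau ht, .inl ⟨_, _, _, hb, rfl, rfl⟩⟩
    | connect_to hT => exact ⟨_, .connect_to hT, .inl ⟨_, _, _, h, rfl, rfl⟩⟩
    | disconnect_to => exact ⟨_, .disconnect_to, .inl ⟨_, _, _, h, rfl, rfl⟩⟩
    | connect_from hT => exact ⟨_, .connect_from hT, .inl ⟨_, _, _, h, rfl, rfl⟩⟩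
    | disconnect_from => exact ⟨_, .disconnect_from, .inl ⟨_, _, _, h, rfl, rfl⟩⟩
    | connect_other h₁ h₂ => exact ⟨_, .connect_other h₁ h₂, .inl ⟨_, _, _, h, rfl, rfl⟩⟩
    | disconnect_other h₁ h₂ => exact ⟨_, .disconnect_other h₁ h₂, .inl ⟨_, _, _, h, rfl, rfl⟩⟩

/-- The label of a composite step is a function of the component labels, which bisimilar components
share. -/
theorem Bisimilar.par {M M' N N' : PartialNet D E.toProcNames}
    (hM : Bisimilar (NetStep E T) M M') (hN : Bisimilar (NetStep E T) N N') :
    Bisimilar (NetStep E T) (.par M N) (.par M' N') := by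
  refine .of_symmetric (fun K L => ∃ M M' N N', Bisimilar (NetStep E T) M M' ∧
    Bisimilar (NetStep E T) N N' ∧ K = .par M N ∧ L = .par M' N') ?_ ?_
    ⟨M, M', N, N', hM, hN, rfl, rfl⟩
  · rintro _ _ ⟨M, M', N, N', hM, hN, rfl, rfl⟩
    exact ⟨M', M, N', N, hM.symm, hN.symm, rfl, rfl⟩
  · rintro _ _ ⟨M, M', N, N', hM, hN, rfl, rfl⟩ a K hK
    cases hK with
    | par_left ha h =>
      obtain ⟨_, h', hb⟩ := hM.exists_step h
      exact ⟨_, .par_left ha h', .inl ⟨_, _, _, _, hb, hN, rfl, rfl⟩⟩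
    | par_right ha h =>
      obtain ⟨_, h', hb⟩ := hN.exists_step h
      exact ⟨_, .par_right ha h', .inl ⟨_, _, _, _, hM, hb, rfl, rfl⟩⟩
    | par_topology ha h₁ h₂ =>
      obtain ⟨_, h₁', hb₁⟩ := hM.exists_step h₁
      obtain ⟨_, h₂', hb₂⟩ := hN.exists_step h₂
      exact ⟨_, .par_topology ha h₁' h₂', .inl ⟨_, _, _, _, hb₁, hb₂, rfl, rfl⟩⟩
    | par_traffic h₁ h₂ =>
      obtain ⟨_, h₁', hb₁⟩ := hM.exists_step h₁
      obtain ⟨_, h₂', hb₂⟩ := hN.exists_step h₂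
      exact ⟨_, .par_traffic h₁' h₂', .inl ⟨_, _, _, _, hb₁, hb₂, rfl, rfl⟩⟩

/-- A `tick` hides a label in which traffic sent and received agree; the matching step of `M'` has
the very same label, so it yields a `tick` as well. -/
theorem Bisimilar.encap {M M' : PartialNet D E.toProcNames}
    (h : Bisimilar (NetStep E T) M M') :
    Bisimilar (CompleteStep E T) (.encap M) (.encap M') := by
  refine .of_symmetric (fun K L => ∃ M M', Bisimilar (NetStep E T) M M' ∧
    K = .encap M ∧ L = .encap M') ?_ ?_ ⟨M, M', h, rfl, rfl⟩
  · rintro _ _ ⟨M, M', h, rfl, rfl⟩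
    exact ⟨M', M, h.symm, rfl, rfl⟩
  · rintro _ _ ⟨M, M', h, rfl, rfl⟩ a K hK
    cases hK with
    | interleaved ha hs =>
      obtain ⟨_, ht, hb⟩ := h.exists_step hs
      exact ⟨_, .interleaved ha ht, .inl ⟨_, _, hb, rfl, rfl⟩⟩
    | topology ha hs =>
      obtain ⟨_, ht, hb⟩ := h.exists_step hs
      exact ⟨_, .topology ha ht, .inl ⟨_, _, hb, rfl, rfl⟩⟩
    | tick hs =>
      obtain ⟨_, ht, hb⟩ := h.exists_step hs
      exact ⟨_, .tick ht, .inl ⟨_, _, hb, rfl, rfl⟩⟩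

end Networks

end LinkLayer

/-! ### The congruence theorem. -/

theorem theorem2 {D : LinkLayer.DataStructure.{u}} (E : LinkLayer.Spec D) :
    -- bisimilarity is an equivalence on sequential states and on sequential process expressions
    Equivalence (LinkLayer.Bisimilar (LinkLayer.SeqStep E)) ∧
    Equivalence (LinkLayer.SeqBisimilar E) ∧
    -- the operators on sequential process expressions
    (∀ (φ : LinkLayer.Formula D) (P P' : LinkLayer.SP D E.toProcNames),
      LinkLayer.SeqBisimilar E P P' →
      LinkLayer.SeqBisimilar E (.guard φ P) (.guard φ P')) ∧
    (∀ (t : LinkLayer.Ty D.Extra) (x : LinkLayer.SpecVar D t) (e : LinkLayer.Expr D t)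
      (P P' : LinkLayer.SP D E.toProcNames),
      LinkLayer.SeqBisimilar E P P' →
      LinkLayer.SeqBisimilar E (.assign x e P) (.assign x e P')) ∧
    (∀ (ms : LinkLayer.Expr D .msg) (P P' : LinkLayer.SP D E.toProcNames),
      LinkLayer.SeqBisimilar E P P' →
      LinkLayer.SeqBisimilar E (.transmit ms P) (.transmit ms P')) ∧
    (∀ (x : LinkLayer.SpecVar D .data) (y : LinkLayer.SpecVar D .ip)
      (P P' : LinkLayer.SP D E.toProcNames),
      LinkLayer.SeqBisimilar E P P' →
      LinkLayer.SeqBisimilar E (.newpkt x y P) (.newpkt x y P')) ∧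
    (∀ (x : LinkLayer.SpecVar D .data) (P P' : LinkLayer.SP D E.toProcNames),
      LinkLayer.SeqBisimilar E P P' →
      LinkLayer.SeqBisimilar E (.deliver x P) (.deliver x P')) ∧
    (∀ P P' Q Q' : LinkLayer.SP D E.toProcNames,
      LinkLayer.SeqBisimilar E P P' → LinkLayer.SeqBisimilar E Q Q' →
      LinkLayer.SeqBisimilar E (.choice P Q) (.choice P' Q')) ∧
    -- the operators that run their operands in the current valuation, on sequential states
    (∀ (ξ ζ : LinkLayer.Valuation D) (x : LinkLayer.SpecVar D .data)
      (P P' : LinkLayer.SP D E.toProcNames), ξ.get x = ζ.get x →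
      LinkLayer.Bisimilar (LinkLayer.SeqStep E) (ξ, P) (ζ, P') →
      LinkLayer.Bisimilar (LinkLayer.SeqStep E) (ξ, .deliver x P) (ζ, .deliver x P')) ∧
    (∀ (ξ ζ : LinkLayer.Valuation D) (P P' Q Q' : LinkLayer.SP D E.toProcNames),
      LinkLayer.Bisimilar (LinkLayer.SeqStep E) (ξ, P) (ζ, P') →
      LinkLayer.Bisimilar (LinkLayer.SeqStep E) (ξ, Q) (ζ, Q') →
      LinkLayer.Bisimilar (LinkLayer.SeqStep E) (ξ, .choice P Q) (ζ, .choice P' Q')) ∧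
    -- node expressions, parallel composition and encapsulation
    (∀ T : Set D.IP,
      Equivalence (LinkLayer.Bisimilar (LinkLayer.NetStep E T)) ∧
      Equivalence (LinkLayer.Bisimilar (LinkLayer.CompleteStep E T)) ∧
      (∀ (id : D.IP) (R : Set D.IP) (s s' : LinkLayer.SeqState D E.toProcNames),
        LinkLayer.Bisimilar (LinkLayer.SeqStep E) s s' →
        LinkLayer.Bisimilar (LinkLayer.NetStep E T) (.node id s R) (.node id s' R)) ∧
      (∀ M M' N N' : LinkLayer.PartialNet D E.toProcNames,
        LinkLayer.Bisimilar (LinkLayer.NetStep E T) M M' →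
        LinkLayer.Bisimilar (LinkLayer.NetStep E T) N N' →
        LinkLayer.Bisimilar (LinkLayer.NetStep E T) (.par M N) (.par M' N')) ∧
      (∀ M M' : LinkLayer.PartialNet D E.toProcNames,
        LinkLayer.Bisimilar (LinkLayer.NetStep E T) M M' →
        LinkLayer.Bisimilar (LinkLayer.CompleteStep E T) (.encap M) (.encap M'))) := by
  exact ⟨LinkLayer.Bisimilar.equivalence _, LinkLayer.SeqBisimilar.equivalence E,
    fun φ _ _ h => h.guard φ, fun _ x e _ _ h => h.assign x e,
    fun ms _ _ h => h.transmit ms, fun x y _ _ h => h.newpkt x y,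
    -- For these two operators the claim on expressions is the claim on states with equal
    -- valuations.
    fun x _ _ h ξ => .deliver x rfl (h ξ), fun _ _ _ _ hP hQ ξ => (hP ξ).choice (hQ ξ),
    fun _ _ x _ _ hx h => .deliver x hx h, fun _ _ _ _ _ _ hP hQ => hP.choice hQ,
    fun _ => ⟨LinkLayer.Bisimilar.equivalence _, LinkLayer.Bisimilar.equivalence _,
      fun id R _ _ h => h.node id R,
      fun _ _ _ _ hM hN => hM.par hN, fun _ _ h => h.encap⟩⟩
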